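/- For positive integers $l$ and $m$, let $SK_{1,l}$ denote the subdivided star obtained from $l$ copies of the path $P_3$ on three vertices by identifying exactly one pendant vertex of each copy to a single vertex (the coalescence vertex), and let the double subdivided star $T_{l,m}$ be the graph obtained from the disjoint union of $SK_{1,l}$ and $SK_{1,m}$ by adding an edge between the two coalescence vertices. For a finite simple graph $G$ with adjacency matrix $A$, let $U(t)=\exp(itA)$, $t\in\mathbb{R}$; one says that $G$ exhibits perfect state transfer between two distinct vertices $a$ and $b$ if there exist $\tau\in\mathbb{R}$ and $\gamma\in\mathbb{C}$ with $U(\tau)\mathbf{e}_a=\gamma\,\mathbf{e}_b$, where $\mathbf{e}_a$ is the characteristic vector of $a$. Then, for all positive integers $l$ and $m$, there is no perfect state transfer in $T_{l,m}$ between any pair of distinct vertices. -/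

import Mathlib

/-- The vertices of the subdivided star with `l` branches: the coalescence vertex `Sum.inl ()`,
and in the `j`-th branch the middle vertex `Sum.inr (Sum.inl j)` and the pendant vertex
`Sum.inr (Sum.inr j)`. -/
abbrev SubdividedStarVertex (l : ℕ) : Type := Unit ⊕ (Fin l ⊕ Fin l)

/-- The coalescence vertex of the subdivided star. -/
abbrev coalescenceVertex (l : ℕ) : SubdividedStarVertex l := Sum.inl ()

/-- The subdivided star `SK_{1,l}`: `l` copies of the path on three vertices, glued along one end
vertex of each. The two edges of the `j`-th branch are
`coalescence vertex -- middle vertex j` and `middle vertex j -- pendant vertex j`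
(`SimpleGraph.fromRel` symmetrizes the relation). -/
def subdividedStar (l : ℕ) : SimpleGraph (SubdividedStarVertex l) :=
  SimpleGraph.fromRel fun x y =>
    match x, y with
    | Sum.inl _, Sum.inr (Sum.inl _) => True
    | Sum.inr (Sum.inl j), Sum.inr (Sum.inr k) => j = k
    | _, _ => False

/-- The double subdivided star `T_{l,m}`: the disjoint union of `SK_{1,l}` and `SK_{1,m}` together
with one more edge joining the two coalescence vertices. -/
def doubleSubdividedStar (l m : ℕ) :
    SimpleGraph (SubdividedStarVertex l ⊕ SubdividedStarVertex m) :=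
  (subdividedStar l ⊕g subdividedStar m) ⊔
    SimpleGraph.edge (Sum.inl (coalescenceVertex l)) (Sum.inr (coalescenceVertex m))

open Classical in
/-- The transition matrix `U(t) = exp(i t A)` of the continuous-time quantum walk on `G`, where `A`
is the adjacency matrix of `G`. -/
noncomputable def transitionMatrix {V : Type*} [Fintype V] [DecidableEq V] (G : SimpleGraph V)
    (t : ℝ) : Matrix V V ℂ :=
  NormedSpace.exp ((Complex.I * (t : ℂ)) • G.adjMatrix ℂ)

/-- `G` exhibits perfect state transfer between the distinct vertices `a` and `b`:
`U(τ) e_a = γ e_b` for some real `τ` and some complex `γ`. -/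
def PerfectStateTransfer {V : Type*} [Fintype V] [DecidableEq V] (G : SimpleGraph V)
    (a b : V) : Prop :=
  a ≠ b ∧ ∃ (τ : ℝ) (γ : ℂ),
    (transitionMatrix G τ).mulVec (Pi.single a 1) = γ • (Pi.single b 1 : V → ℂ)

/-! Each root `x = θ ^ 2` of the cubic `x (x - 1 - l) (x - 1 - m) = (x - 1) ^ 2` gives eigenvalues
`±θ` whose eigenvectors vanish nowhere and agree up to signs, the graph being bipartite. State
transfer at time `τ ≠ 0` from any vertex then forces `exp (4 i τ θ) = 1`, so `x = c n ^ 2` with `n`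
an integer and `c = (π / (2 τ)) ^ 2` common to all three roots. The roots sum to the positive
integer `l + m + 3`, so `c`, and hence every root, is rational. But the cubic has no rational root.
-/

open scoped Matrix.Norms.Operator in
/-- A left eigenvector of `M` is a left eigenvector of `exp M`. -/
theorem Matrix.vecMul_exp_of_vecMul_eq_smul {n : Type*} [Fintype n] [DecidableEq n]
    {M : Matrix n n ℂ} {w : n → ℂ} {c : ℂ} (h : Matrix.vecMul w M = c • w) :
    Matrix.vecMul w (NormedSpace.exp M) = Complex.exp c • w := by
  cases isEmpty_or_nonempty n
  · exact Subsingleton.elim _ _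
  have i₀ : n := Classical.arbitrary n
  -- Repeating `w` in every row turns the eigenvector equation into a semiconjugacy of `M` with a
  -- scalar matrix, which passes to exponentials.
  let W : Matrix n n ℂ := Matrix.of fun _ => w
  have row (N : Matrix n n ℂ) : (W * N) i₀ = Matrix.vecMul w N := rfl
  have hW : SemiconjBy W M (algebraMap ℂ (Matrix n n ℂ) c) := by
    rw [SemiconjBy, ← Algebra.smul_def]
    ext i j
    exact congrFun h j
  have := hW.exp_right
  rw [SemiconjBy, ← NormedSpace.algebraMap_exp_comm, ← Algebra.smul_def,
    ← Complex.exp_eq_exp_ℂ] at this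
  exact (row _).symm.trans (congrFun this i₀)

/-- A left eigenvector of the adjacency matrix relates the phases of a perfect state transfer. -/
theorem exp_mul_apply_eq_of_transfer {V : Type*} [Fintype V] [DecidableEq V] {G : SimpleGraph V}
    [DecidableRel G.Adj] {a b : V} {τ : ℝ} {γ : ℂ}
    (h : (transitionMatrix G τ).mulVec (Pi.single a 1) = γ • (Pi.single b 1 : V → ℂ))
    {w : V → ℂ} {θ : ℂ} (hw : Matrix.vecMul w (G.adjMatrix ℂ) = θ • w) :
    Complex.exp (Complex.I * τ * θ) * w a = γ * w b := by
  have hU : Matrix.vecMul w (transitionMatrix G τ) = Complex.exp (Complex.I * τ * θ) • w := by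
    apply Matrix.vecMul_exp_of_vecMul_eq_smul
    rw [Matrix.vecMul_smul, mul_smul (Complex.I * τ)]
    congr 1
    convert hw
  have := congrArg (fun x => w ⬝ᵥ x) h
  simp only [Matrix.dotProduct_mulVec, hU] at this
  simpa using this

/-- The polynomial whose roots are the squares of the eigenvalues of `T_{l,m}` other than `±1`. -/
def quotientCubic (R : Type*) [CommRing R] (l m : ℕ) : Cubic R :=
  ⟨1, -(l + m + 3), (l + 1) * (m + 1) + 2, -1⟩

/-- `x` is a root of `quotientCubic ℂ l m`. -/
def IsQuotientRoot (l m : ℕ) (x : ℂ) : Prop :=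
  x * (x - 1 - l) * (x - 1 - m) = (x - 1) ^ 2

/-- The vector on `T_{l,m}` that is an eigenvector for `θ` when `θ ^ 2` is a root of
`quotientCubic ℤ l m`. -/
def quotientEigenvector (l m : ℕ) (θ : ℂ) : SubdividedStarVertex l ⊕ SubdividedStarVertex m → ℂ
  | Sum.inl (Sum.inl _) => (θ ^ 2 - 1) * (θ * (θ ^ 2 - 1 - m))
  | Sum.inl (Sum.inr (Sum.inl _)) => θ ^ 2 * (θ ^ 2 - 1 - m)
  | Sum.inl (Sum.inr (Sum.inr _)) => θ * (θ ^ 2 - 1 - m)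
  | Sum.inr (Sum.inl _) => (θ ^ 2 - 1) ^ 2
  | Sum.inr (Sum.inr (Sum.inl _)) => θ * (θ ^ 2 - 1)
  | Sum.inr (Sum.inr (Sum.inr _)) => θ ^ 2 - 1

/-- Each entry is even or odd in `θ` according to the side of the bipartition, so squaring removes
the sign. -/
theorem quotientEigenvector_neg_sq (l m : ℕ) (θ : ℂ)
    (a : SubdividedStarVertex l ⊕ SubdividedStarVertex m) :
    quotientEigenvector l m (-θ) a ^ 2 = quotientEigenvector l m θ a ^ 2 := by
  rcases a with (_ | _ | _) | (_ | _ | _) <;> simp only [quotientEigenvector] <;> ring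

-- Only the equation at the coalescence vertex of the `l`-star needs the cubic; the other five are
-- identities in `θ`.
open Classical in
theorem vecMul_quotientEigenvector {l m : ℕ} {θ : ℂ} (h : IsQuotientRoot l m (θ ^ 2)) :
    Matrix.vecMul (quotientEigenvector l m θ) ((doubleSubdividedStar l m).adjMatrix ℂ) =
      θ • quotientEigenvector l m θ := by
  unfold IsQuotientRoot at h
  funext a
  rcases a with (_ | _ | _) | (_ | _ | _) <;>
    simp only [Matrix.vecMul, dotProduct, Fintype.sum_sum_type, SimpleGraph.adjMatrix_apply] <;>
    simp [doubleSubdividedStar, subdividedStar, SimpleGraph.edge_adj, quotientEigenvector]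
  · linear_combination -h
  · ring
  · ring
  · ring
  · ring

theorem IsQuotientRoot.ne_zero {l m : ℕ} {x : ℂ} (h : IsQuotientRoot l m x) : x ≠ 0 := by
  rintro rfl
  norm_num [IsQuotientRoot] at h

theorem IsQuotientRoot.sub_one_ne_zero {l m : ℕ} (hl : 0 < l) (hm : 0 < m) {x : ℂ}
    (h : IsQuotientRoot l m x) : x - 1 ≠ 0 := by
  intro hx
  have : (l : ℂ) * m = 0 := by
    unfold IsQuotientRoot at h
    rw [sub_eq_zero] at hx
    subst hx
    linear_combination h
  norm_cast at this
  exact (Nat.mul_pos hl hm).ne' this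

theorem IsQuotientRoot.sub_ne_zero {l m : ℕ} (hl : 0 < l) (hm : 0 < m) {x : ℂ}
    (h : IsQuotientRoot l m x) : x - 1 - m ≠ 0 := by
  intro hx
  have h1 := h.sub_one_ne_zero hl hm
  rw [IsQuotientRoot, hx, mul_zero] at h
  exact pow_ne_zero 2 h1 h.symm

theorem quotientEigenvector_ne_zero {l m : ℕ} (hl : 0 < l) (hm : 0 < m) {θ : ℂ}
    (h : IsQuotientRoot l m (θ ^ 2)) (a : SubdividedStarVertex l ⊕ SubdividedStarVertex m) :
    quotientEigenvector l m θ a ≠ 0 := by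
  have h0 : θ ≠ 0 := fun h0 => h.ne_zero (by simp [h0])
  have h1 := h.sub_one_ne_zero hl hm
  have h2 := h.sub_ne_zero hl hm
  rcases a with (_ | _ | _) | (_ | _ | _) <;> simp only [quotientEigenvector] <;> positivity

/-- The cubic is monic over `ℤ` with constant term `-1`, so a rational root is `±1`. The root `1`
would give `l m = 0`, and `-1` would give `-(l + 2) (m + 2) = 4`. -/
theorem not_isQuotientRoot_ratCast {l m : ℕ} (hl : 0 < l) (hm : 0 < m) (q : ℚ) :
    ¬ IsQuotientRoot l m q := by
  intro h
  have hq : Polynomial.aeval q (quotientCubic ℤ l m).toPoly = 0 := by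
    have h' : q * (q - 1 - l) * (q - 1 - m) = (q - 1) ^ 2 := by
      unfold IsQuotientRoot at h
      exact_mod_cast h
    simp only [Cubic.toPoly, map_add, map_mul, map_pow, Polynomial.aeval_C, Polynomial.aeval_X]
    simp [quotientCubic]
    linear_combination h'
  obtain ⟨k, rfl, hk⟩ := exists_integer_of_is_root_of_monic
    (Cubic.monic_of_a_eq_one (P := quotientCubic ℤ l m) rfl) hq
  have hk1 : k ∣ 1 := by simpa [quotientCubic] using hk
  rcases Int.isUnit_iff.1 (isUnit_of_dvd_one hk1) with rfl | rfl
  · exact h.sub_one_ne_zero hl hm (by simp)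
  · have h' : (-1 : ℤ) * (-1 - 1 - l) * (-1 - 1 - m) = (-1 - 1) ^ 2 := by
      unfold IsQuotientRoot at h
      norm_num at h
      have h2 : ((-1 * (-1 - 1 - l) * (-1 - 1 - m) : ℤ) : ℂ) = (((-1 - 1) ^ 2 : ℤ) : ℂ) := by
        push_cast
        linear_combination h
      exact_mod_cast h2
    nlinarith [Int.natCast_nonneg l, Int.natCast_nonneg m,
      mul_nonneg (Int.natCast_nonneg l) (Int.natCast_nonneg m)]

/-- The roots are listed with multiplicity; Vieta's formula for their sum needs no distinctness. -/
theorem exists_quotientRoots (l m : ℕ) : ∃ x y z : ℂ, IsQuotientRoot l m x ∧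
    IsQuotientRoot l m y ∧ IsQuotientRoot l m z ∧ x + y + z = l + m + 3 := by
  have ha : (quotientCubic ℂ l m).a ≠ 0 := one_ne_zero
  obtain ⟨x, y, z, h⟩ := (Cubic.splits_iff_roots_eq_three (φ := RingHom.id ℂ) ha).1
    (IsAlgClosed.splits _)
  have hroot (t : ℂ) (ht : t ∈ (Cubic.map (RingHom.id ℂ) (quotientCubic ℂ l m)).roots) :
      IsQuotientRoot l m t := by
    rw [Cubic.map_roots, Polynomial.map_id] at ht
    replace ht := (Cubic.mem_roots_iff (Cubic.ne_zero_of_a_ne_zero ha) t).1 ht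
    simp [quotientCubic] at ht
    unfold IsQuotientRoot
    linear_combination ht
  refine ⟨x, y, z, hroot x (by simp [h]), hroot y (by simp [h]), hroot z (by simp [h]), ?_⟩
  have hb := Cubic.b_eq_three_roots ha h
  simp [quotientCubic] at hb
  linear_combination hb

/-- If the walk transfers the state between two vertices at time `τ`, every root of the cubic is
an integer square up to a common factor. -/
theorem exists_int_of_transfer {l m : ℕ} (hl : 0 < l) (hm : 0 < m)
    {a b : SubdividedStarVertex l ⊕ SubdividedStarVertex m} {τ : ℝ} {γ : ℂ}
    (h : (transitionMatrix (doubleSubdividedStar l m) τ).mulVec (Pi.single a 1) =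
      γ • (Pi.single b 1 : SubdividedStarVertex l ⊕ SubdividedStarVertex m → ℂ))
    (hτ : τ ≠ 0) {x : ℂ} (hx : IsQuotientRoot l m x) :
    ∃ n : ℤ, x = (Real.pi / (2 * τ)) ^ 2 * n ^ 2 := by
  classical
  obtain ⟨θ, rfl⟩ := IsAlgClosed.exists_pow_nat_eq x (n := 2) two_pos
  have h₁ := exp_mul_apply_eq_of_transfer h (vecMul_quotientEigenvector hx)
  have h₂ := exp_mul_apply_eq_of_transfer h
    (vecMul_quotientEigenvector (θ := -θ) (by rwa [neg_sq]))
  -- Squaring removes the signs at both `a` and `b`: both sides times the squared entry at `a` equal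
  -- `γ ^ 2` times the squared entry at `b`.
  have h₃ : Complex.exp (Complex.I * τ * θ) ^ 2 = Complex.exp (Complex.I * τ * -θ) ^ 2 := by
    apply mul_right_cancel₀ (pow_ne_zero 2 (quotientEigenvector_ne_zero hl hm hx a))
    nth_rw 2 [← quotientEigenvector_neg_sq]
    rw [← mul_pow, ← mul_pow, h₁, h₂, mul_pow, mul_pow, quotientEigenvector_neg_sq]
  rw [← Complex.exp_nat_mul, ← Complex.exp_nat_mul, Complex.exp_eq_exp_iff_exists_int] at h₃
  obtain ⟨n, hn⟩ := h₃
  have hτ' : (τ : ℂ) ≠ 0 := by exact_mod_cast hτ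
  have hθ : θ = Real.pi / (2 * τ) * n := by
    rw [div_mul_eq_mul_div, eq_div_iff (mul_ne_zero two_ne_zero hτ')]
    apply mul_left_cancel₀ Complex.I_ne_zero
    push_cast at hn
    linear_combination hn / 2
  exact ⟨n, by rw [hθ, mul_pow]⟩

theorem theorem3p1 (l m : ℕ) (hl : 0 < l) (hm : 0 < m)
    (a b : SubdividedStarVertex l ⊕ SubdividedStarVertex m) :
    ¬ PerfectStateTransfer (doubleSubdividedStar l m) a b := by
  rintro ⟨hab, τ, γ, h⟩
  by_cases hτ : τ = 0
  · have := congrFun h a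
    simp [transitionMatrix, hτ, hab] at this
  obtain ⟨x, y, z, hx, hy, hz, hsum⟩ := exists_quotientRoots l m
  obtain ⟨i, rfl⟩ := exists_int_of_transfer hl hm h hτ hx
  obtain ⟨j, rfl⟩ := exists_int_of_transfer hl hm h hτ hy
  obtain ⟨k, rfl⟩ := exists_int_of_transfer hl hm h hτ hz
  set c : ℂ := (Real.pi / (2 * τ)) ^ 2
  have hN : (i : ℂ) ^ 2 + j ^ 2 + k ^ 2 ≠ 0 := by
    intro h0
    have : ((l + m + 3 : ℕ) : ℂ) = 0 := by
      push_cast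
      linear_combination c * h0 - hsum
    exact absurd (Nat.cast_eq_zero.1 this) (by lia)
  -- The sum of the roots gives `c = (l + m + 3) / (i ^ 2 + j ^ 2 + k ^ 2)`, so this rational number
  -- is the root `c * i ^ 2`.
  apply not_isQuotientRoot_ratCast hl hm ((l + m + 3) / (i ^ 2 + j ^ 2 + k ^ 2) * i ^ 2)
  convert hx
  push_cast
  rw [← hsum]
  field_simp
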